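/- Conventions. Let $\beta>1$ be real. The expansion $d_\beta(1)=d_1d_2\cdots$ is the greedy (Rényi) expansion of $1$ in base $\beta$: $d_i=\lfloor \beta x_{i-1}\rfloor$, $x_i=\beta x_{i-1}-d_i$, $x_0=1$. If $d_\beta(1)=d_1\cdots d_\ell 0^\omega$ with $d_\ell\neq 0$, put $d_\beta^*(1)=(d_1\cdots d_{\ell-1}(d_\ell-1))^\omega$; otherwise put $d_\beta^*(1)=d_\beta(1)$. The number $\beta$ is a Parry number if $d_\beta(1)$ ends in $0^\omega$ or is ultimately periodic. For a strictly increasing sequence of weights $U=(U_i)_{i\ge 0}$ with $U_0=1$, the greedy numeration system with weights $U$ represents $0$ by $\varepsilon$ and represents $n\ge 1$ by the word $w_{k-1}\cdots w_0$ that the greedy algorithm gives, where $U_{k-1}\le n<U_k$: $w_{k-1}$ is the quotient of $n$ by $U_{k-1}$, $w_{k-2}$ is the quotient of the remainder by $U_{k-2}$, and so on. The Bertrand numeration systems associated with Parry numbers are the greedy numeration systems with the following weights: 1. (canonical) $U_i=d_1U_{i-1}+d_2U_{i-2}+\cdots+d_iU_0+1$ for $i\ge 0$ (so $U_0=1$),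 where $d_1d_2\cdots=d_\beta^*(1)$ for a Parry number $\beta$; 2. (non-canonical) the same with $d_1d_2\cdots=d_\beta(1)$ for a Parry number $\beta$; 3. (trivial) $U_i=i+1$ for $i\ge 0$. A substitution is a morphism $\mu\colon A^*\to A^*$ over a finite alphabet $A$ such that $\mu(b)\neq\varepsilon$ for every letter $b$ and some letter $a$ is growing, i.e. $|\mu^n(a)|\to\infty$. It is Fabre-like if it has the form $a_1\mapsto a_1^{d_1}a_2,\ a_2\mapsto a_1^{d_2}a_3,\ \ldots,\ a_{n-1}\mapsto a_1^{d_{n-1}}a_n,\ a_n\mapsto a_1^{d_n}a_k$, where $n\ge 1$, $A=\{a_1,\ldots,a_n\}$, $1\le k\le n$, $d_1\geq 1$ and $d_2,\ldots,d_n\ge 0$. Let $u=u_0u_1u_2\cdots$ be a right-infinite fixed point of a substitution $\mu$ whose first letter $u_0$ is growing. In the Dumont–Thomas numeration system associated with $\mu$ and $u$, the number $0$ is represented by $\varepsilon$, and $n\ge 1$ is represented by the word $|m_{k-1}|\,|m_{k-2}|\cdots|m_0|$, where $((m_i,a_i))_{0\le i\le k-1}$, $k\geq 1$, is the unique sequence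 in $A^*\times A$ such that $m_{k-1}a_{k-1}$ is a prefix of $\mu(u_0)$, $m_{i-1}a_{i-1}$ is a prefix of $\mu(a_i)$ for $1\le i\le k-1$, $m_{k-1}\ne\varepsilon$, and $u_0\cdots u_{n-1}=\mu^{k-1}(m_{k-1})\cdots\mu^0(m_0)$. Two numeration systems over $\mathbb N$ are equal if every natural number is represented by the same word in both. Proposition. Every Bertrand numeration system associated with a Parry number (canonical, non-canonical or trivial) is equal to the Dumont–Thomas numeration system associated with some Fabre-like substitution $\mu$ and its fixed point $u$ with (growing) first letter $a_1$. -/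

import Mathlib

namespace DTNum

/-! ### Morphisms and substitutions

A morphism `A* → A*` is given by the images of the letters, `μ : A → List A`; a right-infinite
word over `A` is a function `ℕ → A`. -/

/-- The image of a finite word under the morphism `μ`. -/
def applyWord {A : Type*} (μ : A → List A) (w : List A) : List A := w.flatMap μ

/-- The word `μ^k(w)`. -/
def powWord {A : Type*} (μ : A → List A) (k : ℕ) (w : List A) : List A := (applyWord μ)^[k] w

/-- The letter `a` is growing: `|μ^k(a)| → ∞`. -/
def IsGrowing {A : Type*} (μ : A → List A) (a : A) : Prop :=
  Filter.Tendsto (fun k : ℕ => (powWord μ k [a]).length) Filter.atTop Filter.atTop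

/-- A substitution is a morphism with non-empty images of letters and at least one
growing letter. -/
def IsSubstitution {A : Type*} (μ : A → List A) : Prop :=
  (∀ a, μ a ≠ []) ∧ ∃ a, IsGrowing μ a

/-- The prefix `u_0 ⋯ u_{n-1}` of the right-infinite word `u`. -/
def wordPrefix {A : Type*} (u : ℕ → A) (n : ℕ) : List A := (List.range n).map u

/-- `μ(u) = u`: the image of every prefix of `u` is a prefix of `u`. For non-erasing `μ` these
images are arbitrarily long, so this says precisely that the infinite words `μ(u)` and `u`
are equal. -/
def IsFixedPoint {A : Type*} (μ : A → List A) (u : ℕ → A) : Prop :=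
  ∀ n, applyWord μ (wordPrefix u n) = wordPrefix u (applyWord μ (wordPrefix u n)).length

/-! ### Dumont–Thomas numeration systems -/

/-- `a`-admissible sequences `(m_{k-1}, a_{k-1}), …, (m_0, a_0)`, listed by decreasing index:
`m_{k-1} a_{k-1}` is a prefix of `μ(a)` and `m_{i-1} a_{i-1}` is a prefix of `μ(a_i)` for
`1 ≤ i ≤ k - 1`. -/
def IsAdmissible {A : Type*} (μ : A → List A) : A → List (List A × A) → Prop
  | _, [] => True
  | a, (m, b) :: s => m ++ [b] <+: μ a ∧ IsAdmissible μ b s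

/-- The word `μ^{k-1}(m_{k-1}) μ^{k-2}(m_{k-2}) ⋯ μ^0(m_0)` of the sequence
`(m_{k-1}, a_{k-1}), …, (m_0, a_0)`. -/
def admWord {A : Type*} (μ : A → List A) : List (List A × A) → List A
  | [] => []
  | (m, _) :: s => powWord μ s.length m ++ admWord μ s

/-- The word `w` is a representation of `n` in the Dumont–Thomas system of `μ` and `u`: it is
empty if `n = 0`, and for `n ≥ 1` it is `|m_{k-1}| ⋯ |m_0|` for a `u_0`-admissible sequence with
`m_{k-1} ≠ ε` and `u_0 ⋯ u_{n-1} = μ^{k-1}(m_{k-1}) ⋯ μ^0(m_0)`. -/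
def IsDTRep {A : Type*} (μ : A → List A) (u : ℕ → A) (n : ℕ) (w : List ℕ) : Prop :=
  if n = 0 then w = [] else
    ∃ (m : List A) (b : A) (s : List (List A × A)),
      IsAdmissible μ (u 0) ((m, b) :: s) ∧ m ≠ [] ∧
      wordPrefix u n = admWord μ ((m, b) :: s) ∧
      w = ((m, b) :: s).map (fun p => p.1.length)

/-- `rep` is the representation map of the Dumont–Thomas numeration system associated with the
substitution `μ` and its right-infinite fixed point `u` with growing seed `u_0`: the word `rep n`
is the one and only Dumont–Thomas representation of `n`. -/
structure IsDumontThomasSystem {A : Type*} (μ : A → List A) (u : ℕ → A) (rep : ℕ → List ℕ) :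
    Prop where
  substitution : IsSubstitution μ
  fixed : IsFixedPoint μ u
  growing : IsGrowing μ (u 0)
  rep_iff : ∀ (n : ℕ) (w : List ℕ), IsDTRep μ u n w ↔ w = rep n

/-- Fabre-like substitutions
`a_1 ↦ a_1^{d_1} a_2, a_2 ↦ a_1^{d_2} a_3, …, a_n ↦ a_1^{d_n} a_k`, with `n ≥ 1`, `1 ≤ k ≤ n`,
`d_i ≥ 0` and `d_1 > 0`. Here `n = N + 1`, and the letter `a_i` is `i - 1 : Fin (N + 1)`. -/
def IsFabreLike {N : ℕ} (μ : Fin (N + 1) → List (Fin (N + 1))) : Prop :=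
  ∃ (d : Fin (N + 1) → ℕ) (k : Fin (N + 1)), 0 < d 0 ∧
    (∀ i : Fin N, μ i.castSucc = List.replicate (d i.castSucc) 0 ++ [i.succ]) ∧
    μ (Fin.last N) = List.replicate (d (Fin.last N)) 0 ++ [k]

/-! ### Expansions of `1` in base `β` and Parry numbers

Infinite digit words `d_1 d_2 ⋯` are functions `d : ℕ → ℕ`, with `d_i` equal to `d (i - 1)`. -/

/-- The orbit of `1` under `x ↦ βx - ⌊βx⌋`. -/
noncomputable def betaOrbit (β : ℝ) : ℕ → ℝ
  | 0 => 1
  | i + 1 => Int.fract (β * betaOrbit β i)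

/-- The (greedy, Rényi) expansion `d_β(1)`. -/
noncomputable def dBeta (β : ℝ) (i : ℕ) : ℕ := ⌊β * betaOrbit β i⌋₊

/-- The word ends in `0^ω`. -/
def IsFiniteExpansion (d : ℕ → ℕ) : Prop := ∃ N, ∀ i, N ≤ i → d i = 0

/-- The word is ultimately periodic. -/
def IsUltimatelyPeriodic (d : ℕ → ℕ) : Prop := ∃ N p, 0 < p ∧ ∀ i, N ≤ i → d (i + p) = d i

/-- Parry numbers: `β > 1` such that `d_β(1)` is finite or ultimately periodic. -/
def IsParry (β : ℝ) : Prop :=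
  1 < β ∧ (IsFiniteExpansion (dBeta β) ∨ IsUltimatelyPeriodic (dBeta β))

open Classical in
/-- `(d_1 ⋯ d_{ℓ-1} (d_ℓ - 1))^ω` if `d = d_1 ⋯ d_ℓ 0^ω` with `d_ℓ ≠ 0`, and `d` if `d` does not
end in `0^ω`. -/
noncomputable def quasiGreedy (d : ℕ → ℕ) : ℕ → ℕ :=
  if h : IsFiniteExpansion d then
    fun i => if i % Nat.find h + 1 = Nat.find h then d (i % Nat.find h) - 1
      else d (i % Nat.find h)
  else d

/-- The quasi-greedy expansion `d_β^*(1)`. -/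
noncomputable def dBetaStar (β : ℝ) : ℕ → ℕ := quasiGreedy (dBeta β)

/-! ### Bertrand numeration systems -/

/-- The weights `U_i = d_1 U_{i-1} + d_2 U_{i-2} + ⋯ + d_i U_0 + 1` (so `U_0 = 1`). -/
def bertrandWeights (d : ℕ → ℕ) (i : ℕ) : ℕ :=
  (∑ j : Fin i, d j * bertrandWeights d (i - 1 - j)) + 1
termination_by i
decreasing_by omega

/-- The greedy algorithm on the weights `U_{k-1}, …, U_0`, most significant digit first. -/
def greedyDigits (U : ℕ → ℕ) : ℕ → ℕ → List ℕ
  | 0, _ => []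
  | k + 1, n => (n / U k) :: greedyDigits U k (n % U k)

/-- The representation map of the greedy positional numeration system with weights `U` (with
`U_0 = 1` and `U` increasing): the greedy algorithm, started at the largest weight
`U_{k-1} ≤ n`; in particular `0` is represented by the empty word. -/
noncomputable def greedyRep (U : ℕ → ℕ) (n : ℕ) : List ℕ :=
  greedyDigits U (sInf {k | n < U k}) n

/-- Representation maps of the Bertrand numeration systems associated with Parry numbers:
the canonical and the non-canonical one of each Parry number, and the trivial one. -/
inductive IsParryBertrandSystem : (ℕ → List ℕ) → Prop
  | canonical (β : ℝ) (hβ : IsParry β) :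
      IsParryBertrandSystem (greedyRep (bertrandWeights (dBetaStar β)))
  | noncanonical (β : ℝ) (hβ : IsParry β) :
      IsParryBertrandSystem (greedyRep (bertrandWeights (dBeta β)))
  | trivial : IsParryBertrandSystem (greedyRep (fun i => i + 1))

end DTNum

/-!
Let `d` be the digit word that defines the weights `U`. Two properties of `d` suffice: it is
ultimately periodic with `d 0 > 0`, and it is lexicographically at least as large as each of its
shifts (`IsShiftMaximal`). Periodicity lets the automaton that compares a word with `d` be folded
onto finitely many states, which gives the Fabre-like substitution `c ↦ 0^(d c) (next c)`
(`fabre`). The length of `μ^k(c)` is then `d c * U (k-1) + d (c+1) * U (k-2) + ⋯ + 1`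
(`length_powWord_fabre`); in particular `|μ^k(0)| = U k`.

The lexicographic condition gives `|μ^k(c)| ≤ U k` for every letter `c`
(`IsShiftMaximal.tailWeight_le`). Hence, in an admissible sequence, what follows the digit of
weight `U k` contributes less than `U k`: each digit is the quotient that the greedy algorithm
computes (`IsAdmissible.greedyDigits_eq`). Conversely every `n < |μ^k(c)|` is reached by an
admissible sequence (`exists_isAdmissible`).

For `d_β(1)` and `d_β^*(1)` the lexicographic condition comes from real remainders
`y (i + 1) = β * y i - d i` in `[0, 1]` with `y 0 = 1`: as long as the digits agree, the
order between the remainders is preserved (`isShiftMaximal_of_remainders`). The trivial system is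
the one of the word `1 0 0 0 ⋯`.
-/

namespace DTNum

/-! ### Lexicographically shift-maximal digit words -/

/-- No shift of `d` is lexicographically larger than `d`: at the first position where the shift
by `i` may differ from `d`, its digit is not larger. -/
def IsShiftMaximal (d : ℕ → ℕ) : Prop :=
  ∀ i j, (∀ t < j, d (i + t) = d t) → d (i + j) ≤ d j

/-- The value `d_i U_{k-1} + ⋯ + d_{i+k-1} U_0 + 1` of the shift of `d` by `i`, in the weights
`U` of `d` itself. -/
def tailWeight (d : ℕ → ℕ) (k i : ℕ) : ℕ :=
  ∑ j ∈ Finset.range k, d (i + j) * bertrandWeights d (k - 1 - j) + 1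

lemma tailWeight_zero_right (d : ℕ → ℕ) (k : ℕ) : tailWeight d k 0 = bertrandWeights d k := by
  rw [bertrandWeights, tailWeight,
    ← Fin.sum_univ_eq_sum_range (fun j => d (0 + j) * bertrandWeights d (k - 1 - j))]
  simp

lemma tailWeight_zero_left (d : ℕ → ℕ) (i : ℕ) : tailWeight d 0 i = 1 := by
  simp [tailWeight]

lemma tailWeight_succ (d : ℕ → ℕ) (k i : ℕ) :
    tailWeight d (k + 1) i = d i * bertrandWeights d k + tailWeight d k (i + 1) := by
  have h : ∀ j, d (i + (j + 1)) * bertrandWeights d (k + 1 - 1 - (j + 1))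
      = d (i + 1 + j) * bertrandWeights d (k - 1 - j) := by
    intro j
    congr 2
    · ring
    · omega
  rw [tailWeight, tailWeight, Finset.sum_range_succ', Finset.sum_congr rfl (fun j _ => h j)]
  simp
  ring

lemma tailWeight_pos (d : ℕ → ℕ) (k i : ℕ) : 0 < tailWeight d k i := Nat.succ_pos _

lemma bertrandWeights_pos (d : ℕ → ℕ) (k : ℕ) : 0 < bertrandWeights d k :=
  tailWeight_zero_right d k ▸ tailWeight_pos d k 0

lemma bertrandWeights_zero (d : ℕ → ℕ) : bertrandWeights d 0 = 1 := by
  rw [← tailWeight_zero_right, tailWeight_zero_left]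

lemma tailWeight_congr {d : ℕ → ℕ} {i i' : ℕ} (h : ∀ j, d (i + j) = d (i' + j)) (k : ℕ) :
    tailWeight d k i = tailWeight d k i' := by
  simp only [tailWeight, h]

lemma bertrandWeights_strictMono {d : ℕ → ℕ} (h0 : 0 < d 0) :
    StrictMono (bertrandWeights d) := by
  refine strictMono_nat_of_lt_succ fun k => ?_
  rw [← tailWeight_zero_right d (k + 1), tailWeight_succ]
  nlinarith [tailWeight_pos d k (0 + 1), bertrandWeights_pos d k]

/-- The comparison of tails along a common prefix. If the next digits agree the prefix gets
longer; if not, the digit of the shift is smaller by at least one, and this makes up for all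
of the following digits. -/
lemma IsShiftMaximal.tailWeight_add_le {d : ℕ → ℕ} (hd : IsShiftMaximal d) (k : ℕ) :
    ∀ i j, (∀ t < j, d (i + t) = d t) → tailWeight d k (i + j) ≤ tailWeight d k j := by
  induction k with
  | zero => intro i j _; simp [tailWeight_zero_left]
  | succ k ih =>
    intro i j h
    rw [tailWeight_succ, tailWeight_succ]
    rcases (hd i j h).eq_or_lt with he | hlt
    · have := ih i (j + 1) fun t ht => by
        rcases Nat.lt_succ_iff_lt_or_eq.mp ht with h' | rfl
        · exact h t h'
        · exact he
      rw [he]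
      exact Nat.add_le_add_left this _
    · have h1 := ih (i + j + 1) 0 (by simp)
      rw [tailWeight_zero_right] at h1
      have h2 : (d (i + j) + 1) * bertrandWeights d k ≤ d j * bertrandWeights d k :=
        Nat.mul_le_mul_right _ hlt
      rw [Nat.add_mul, Nat.one_mul] at h2
      have h3 : tailWeight d k (i + j + 1) ≤ bertrandWeights d k := h1
      omega

lemma IsShiftMaximal.tailWeight_le {d : ℕ → ℕ} (hd : IsShiftMaximal d) (k i : ℕ) :
    tailWeight d k i ≤ bertrandWeights d k :=
  tailWeight_zero_right d k ▸ hd.tailWeight_add_le k i 0 (by simp)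

/-! ### Powers of a morphism -/

section Morphism

variable {A : Type*} (μ : A → List A)

lemma applyWord_append (v w : List A) :
    applyWord μ (v ++ w) = applyWord μ v ++ applyWord μ w := by
  simp [applyWord]

lemma powWord_append (k : ℕ) (v w : List A) :
    powWord μ k (v ++ w) = powWord μ k v ++ powWord μ k w := by
  induction k generalizing v w with
  | zero => rfl
  | succ k ih => simp only [powWord, Function.iterate_succ_apply, applyWord_append] at *; exact ih _ _

lemma powWord_succ_singleton (k : ℕ) (a : A) : powWord μ (k + 1) [a] = powWord μ k (μ a) := by
  simp [powWord, applyWord]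

lemma powWord_succ (k : ℕ) (w : List A) :
    powWord μ (k + 1) w = applyWord μ (powWord μ k w) := by
  simp only [powWord, Function.iterate_succ_apply']

variable {μ}

lemma powWord_prefix (k : ℕ) {v w : List A} (h : v <+: w) :
    powWord μ k v <+: powWord μ k w := by
  obtain ⟨t, rfl⟩ := h
  exact ⟨powWord μ k t, (powWord_append μ k v t).symm⟩

lemma length_powWord_replicate (k j : ℕ) (a : A) :
    (powWord μ k (List.replicate j a)).length = j * (powWord μ k [a]).length := by
  induction j with
  | zero =>
    have : powWord μ k ([] : List A) = [] := by
      induction k with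
      | zero => rfl
      | succ k ih => rw [powWord_succ, ih]; rfl
    simp [this]
  | succ j ih =>
    rw [List.replicate_succ, ← List.singleton_append, powWord_append, List.length_append, ih]
    ring

/-- An `a`-admissible sequence of length `k` describes a prefix of `μ^k(a)`. -/
lemma IsAdmissible.admWord_prefix {s : List (List A × A)} :
    ∀ {a : A}, IsAdmissible μ a s → admWord μ s <+: powWord μ s.length [a] := by
  induction s with
  | nil => intro a _; exact List.nil_prefix
  | cons p s ih =>
    obtain ⟨m, b⟩ := p
    rintro a ⟨hm, hs⟩
    rw [List.length_cons, powWord_succ_singleton]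
    refine List.IsPrefix.trans ?_ (powWord_prefix _ hm)
    rw [powWord_append, admWord]
    exact (List.prefix_append_right_inj _).mpr (ih hs)

/-! ### The fixed point generated by a prolongable letter -/

lemma wordPrefix_length (u : ℕ → A) (n : ℕ) : (wordPrefix u n).length = n := by
  simp [wordPrefix]

lemma eq_wordPrefix_of_prefix {u : ℕ → A} {n : ℕ} {w : List A} (h : w <+: wordPrefix u n) :
    w = wordPrefix u w.length := by
  have hl : w.length ≤ n := wordPrefix_length u n ▸ h.length_le
  rw [List.prefix_iff_eq_take] at h
  conv_lhs => rw [h]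
  rw [wordPrefix, ← List.map_take, List.take_range, min_eq_left hl, wordPrefix]

lemma powWord_prefix_powWord {a : A} (ha : [a] <+: μ a) {j k : ℕ} (h : j ≤ k) :
    powWord μ j [a] <+: powWord μ k [a] := by
  induction h with
  | refl => exact List.prefix_refl _
  | step _ ih =>
    refine ih.trans ?_
    rw [powWord_succ_singleton]
    exact powWord_prefix _ ha

/-- The limit of the words `μ^k(a)`. The default value `a` is not used when `n < |μ^n(a)|`. -/
def limitWord (μ : A → List A) (a : A) (n : ℕ) : A := (powWord μ n [a]).getD n a

lemma wordPrefix_limitWord {a : A} (ha : [a] <+: μ a)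
    (hlen : ∀ k, k < (powWord μ k [a]).length) (k : ℕ) :
    wordPrefix (limitWord μ a) (powWord μ k [a]).length = powWord μ k [a] := by
  refine List.ext_getElem (wordPrefix_length _ _) fun n h1 h2 => ?_
  have hn := hlen n
  simp only [wordPrefix, List.getElem_map, List.getElem_range, limitWord]
  rw [List.getD_eq_getElem _ _ hn]
  rcases le_total n k with h | h
  · exact (powWord_prefix_powWord ha h).getElem hn
  · exact ((powWord_prefix_powWord ha h).getElem h2).symm

lemma isFixedPoint_limitWord {a : A} (ha : [a] <+: μ a)
    (hlen : ∀ k, k < (powWord μ k [a]).length) : IsFixedPoint μ (limitWord μ a) := by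
  intro n
  have hpre : wordPrefix (limitWord μ a) n <+: powWord μ n [a] := by
    rw [← wordPrefix_limitWord ha hlen n]
    have := (List.take_prefix n (List.range (powWord μ n [a]).length)).map (limitWord μ a)
    rwa [List.take_range, min_eq_left (hlen n).le] at this
  have h := powWord_prefix (μ := μ) 1 hpre
  have h' : applyWord μ (wordPrefix (limitWord μ a) n) <+: powWord μ (n + 1) [a] := by
    rw [powWord_succ]; exact h
  rw [← wordPrefix_limitWord ha hlen (n + 1)] at h'
  exact eq_wordPrefix_of_prefix h'

end Morphism

lemma prefix_replicate_append {A : Type*} {a x b : A} {r : ℕ} {m : List A}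
    (h : m ++ [b] <+: List.replicate r a ++ [x]) :
    m = List.replicate m.length a ∧ (m.length < r ∧ b = a ∨ m.length = r ∧ b = x) := by
  induction r generalizing m with
  | zero =>
    cases m with
    | nil => simpa using h
    | cons y m => simp at h
  | succ r ih =>
    cases m with
    | nil => simpa [List.replicate_succ] using h
    | cons y m =>
      rw [List.replicate_succ, List.cons_append, List.cons_append, List.cons_prefix_cons] at h
      obtain ⟨rfl, h⟩ := h
      obtain ⟨h1, h2⟩ := ih h
      refine ⟨?_, ?_⟩
      · rw [List.length_cons, List.replicate_succ, ← h1]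
      · simpa using h2

/-! ### The Fabre-like substitution of an ultimately periodic digit word -/

/-- The state that follows `c` when the states `N + 1` and `q` are identified. -/
def fabreNext {N : ℕ} (q c : Fin (N + 1)) : Fin (N + 1) :=
  if h : (c : ℕ) < N then ⟨c + 1, by omega⟩ else q

/-- The Fabre-like substitution `c ↦ 0^(d c) (c + 1)`, where `N + 1` is replaced by `q`. -/
def fabre {N : ℕ} (d : ℕ → ℕ) (q c : Fin (N + 1)) : List (Fin (N + 1)) :=
  List.replicate (d c) 0 ++ [fabreNext q c]

lemma isFabreLike_fabre {N : ℕ} {d : ℕ → ℕ} (q : Fin (N + 1)) (h0 : 0 < d 0) :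
    IsFabreLike (fabre d q) := by
  refine ⟨fun c => d c, q, by simpa using h0, fun i => ?_, ?_⟩
  · simp [fabre, fabreNext, Fin.ext_iff]
  · simp [fabre, fabreNext]

section Fabre

variable {N : ℕ} {d : ℕ → ℕ} {q : Fin (N + 1)}

lemma length_powWord_fabre (hq : ∀ j, d (N + 1 + j) = d (q + j)) (k : ℕ) (c : Fin (N + 1)) :
    (powWord (fabre d q) k [c]).length = tailWeight d k c := by
  induction k generalizing c with
  | zero => rw [tailWeight_zero_left]; rfl
  | succ k ih =>
    rw [powWord_succ_singleton, fabre, powWord_append, List.length_append,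
      length_powWord_replicate, ih, ih, tailWeight_succ, Fin.val_zero, tailWeight_zero_right]
    congr 1
    refine tailWeight_congr (fun j => ?_) k
    unfold fabreNext
    split_ifs with h
    · rfl
    · rw [show (c : ℕ) = N by omega, hq]

lemma length_powWord_fabre_zero (hq : ∀ j, d (N + 1 + j) = d (q + j)) (k : ℕ) :
    (powWord (fabre d q) k [0]).length = bertrandWeights d k := by
  rw [length_powWord_fabre hq, Fin.val_zero, tailWeight_zero_right]

/-- The value of an admissible sequence is less than the weight of its starting letter, because
one more letter of the image fits. -/
lemma IsAdmissible.length_admWord_lt (hq : ∀ j, d (N + 1 + j) = d (q + j))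
    {s : List (List (Fin (N + 1)) × Fin (N + 1))} {c : Fin (N + 1)}
    (hs : IsAdmissible (fabre d q) c s) :
    (admWord (fabre d q) s).length < tailWeight d s.length c := by
  induction s generalizing c with
  | nil => exact tailWeight_pos _ _ _
  | cons p s ih =>
    obtain ⟨m, b⟩ := p
    obtain ⟨hm, hs⟩ := hs
    have h1 := (powWord_prefix (μ := fabre d q) s.length hm).length_le
    rw [← powWord_succ_singleton, length_powWord_fabre hq, powWord_append, List.length_append,
      length_powWord_fabre hq] at h1
    have h2 := ih hs
    rw [admWord, List.length_append, List.length_cons]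
    omega

lemma IsAdmissible.length_admWord_cons (hq : ∀ j, d (N + 1 + j) = d (q + j))
    {s : List (List (Fin (N + 1)) × Fin (N + 1))} {c b : Fin (N + 1)} {m : List (Fin (N + 1))}
    (hs : IsAdmissible (fabre d q) c ((m, b) :: s)) :
    (admWord (fabre d q) ((m, b) :: s)).length =
      m.length * bertrandWeights d s.length + (admWord (fabre d q) s).length := by
  have hm := (prefix_replicate_append hs.1).1
  rw [admWord, List.length_append]
  conv_lhs => rw [hm]
  rw [length_powWord_replicate, length_powWord_fabre_zero hq]

/-- The digits of an admissible sequence are those of the greedy algorithm: the value of what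
follows a digit is smaller than the weight of this digit. -/
lemma IsAdmissible.greedyDigits_eq (hd : IsShiftMaximal d)
    (hq : ∀ j, d (N + 1 + j) = d (q + j))
    {s : List (List (Fin (N + 1)) × Fin (N + 1))} {c : Fin (N + 1)}
    (hs : IsAdmissible (fabre d q) c s) :
    greedyDigits (bertrandWeights d) s.length (admWord (fabre d q) s).length =
      s.map (fun p => p.1.length) := by
  induction s generalizing c with
  | nil => rfl
  | cons p s ih =>
    obtain ⟨m, b⟩ := p
    have hlt : (admWord (fabre d q) s).length < bertrandWeights d s.length :=
      (hs.2.length_admWord_lt hq).trans_le (hd.tailWeight_le _ _)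
    rw [hs.length_admWord_cons hq, List.length_cons, greedyDigits, List.map_cons, ← ih hs.2]
    have h1 := Nat.div_eq_of_lt hlt
    have h2 := Nat.mod_eq_of_lt hlt
    rw [Nat.add_comm, Nat.add_mul_div_right _ _ (bertrandWeights_pos d _),
      Nat.add_mul_mod_self_right, h1, h2, Nat.zero_add]

/-- Every `n < |μ^k(c)|` is the value of a `c`-admissible sequence of length `k`, built by taking
the quotient by `U (k - 1)` as the first digit. -/
lemma exists_isAdmissible (hd : IsShiftMaximal d)
    (hq : ∀ j, d (N + 1 + j) = d (q + j)) (k : ℕ) (c : Fin (N + 1)) (n : ℕ)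
    (hn : n < tailWeight d k c) :
    ∃ s, IsAdmissible (fabre d q) c s ∧ s.length = k ∧
      (admWord (fabre d q) s).length = n := by
  induction k generalizing c n with
  | zero =>
    rw [tailWeight_zero_left, Nat.lt_one_iff] at hn
    exact ⟨[], trivial, rfl, hn.symm⟩
  | succ k ih =>
    have hU := bertrandWeights_pos d k
    have hdm := Nat.div_add_mod' n (bertrandWeights d k)
    have hmod := Nat.mod_lt n hU
    -- It is enough to choose the target letter of the quotient digit.
    have key : ∀ b : Fin (N + 1), List.replicate (n / bertrandWeights d k) 0 ++ [b] <+: fabre d q c →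
        n % bertrandWeights d k < tailWeight d k b →
        ∃ s, IsAdmissible (fabre d q) c s ∧ s.length = k + 1 ∧
          (admWord (fabre d q) s).length = n := by
      intro b hb hlt
      obtain ⟨s, hs, hk, hl⟩ := ih b _ hlt
      have hs' : IsAdmissible (fabre d q) c
        ((List.replicate (n / bertrandWeights d k) 0, b) :: s) := ⟨hb, hs⟩
      refine ⟨_, hs', by simp [hk], ?_⟩
      rw [hs'.length_admWord_cons hq, hl, hk, List.length_replicate, hdm]
    rcases lt_or_ge (n / bertrandWeights d k) (d c) with h | h
    · refine key 0 ?_ (by rwa [Fin.val_zero, tailWeight_zero_right])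
      refine List.IsPrefix.trans ?_ (List.prefix_append _ _)
      rw [← List.replicate_succ']
      exact ⟨List.replicate (d c - (n / bertrandWeights d k + 1)) 0, by
        rw [List.replicate_append_replicate, Nat.add_sub_cancel' h]⟩
    · -- Cancel the contribution of the letters `0` in the two expressions for `|μ^(k+1)(c)|`.
      have hnext : tailWeight d k (fabreNext q c) = tailWeight d k (c + 1) := by
        have h1 := length_powWord_fabre hq (k + 1) c
        rw [powWord_succ_singleton, fabre, powWord_append, List.length_append,
          length_powWord_replicate, length_powWord_fabre_zero hq, length_powWord_fabre hq,
          tailWeight_succ] at h1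
        omega
      rw [tailWeight_succ] at hn
      have hle := hd.tailWeight_le k (c + 1)
      have heq : n / bertrandWeights d k = d c := by
        refine le_antisymm (Nat.lt_succ_iff.mp ?_) h
        rw [Nat.div_lt_iff_lt_mul hU, Nat.succ_mul]
        omega
      refine key (fabreNext q c) (by rw [heq]; exact List.prefix_refl _) ?_
      rw [hnext]
      rw [heq] at hdm
      omega

end Fabre

/-! ### Equality of the two numeration systems -/

lemma sInf_weight_eq {U : ℕ → ℕ} (hU : Monotone U) {k n : ℕ} (h1 : U k ≤ n)
    (h2 : n < U (k + 1)) : sInf {k | n < U k} = k + 1 := by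
  refine le_antisymm (Nat.sInf_le h2) (le_csInf ⟨_, h2⟩ fun j hj => ?_)
  by_contra hlt
  have := hU (show j ≤ k by omega)
  have hj' : n < U j := hj
  omega

theorem isDumontThomasSystem_fabre {N : ℕ} {d : ℕ → ℕ} {q : Fin (N + 1)} (h0 : 0 < d 0)
    (hd : IsShiftMaximal d) (hq : ∀ j, d (N + 1 + j) = d (q + j)) :
    limitWord (fabre d q) 0 0 = 0 ∧
      IsDumontThomasSystem (fabre d q) (limitWord (fabre d q) 0)
        (greedyRep (bertrandWeights d)) := by
  have hmono := bertrandWeights_strictMono h0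
  have ha : [(0 : Fin (N + 1))] <+: fabre d q 0 := by
    obtain ⟨r, hr⟩ := Nat.exists_eq_succ_of_ne_zero h0.ne'
    simp [fabre, hr, List.replicate_succ]
  have hlen : ∀ k, k < (powWord (fabre d q) k [0]).length := by
    intro k
    rw [length_powWord_fabre_zero hq]
    have := hmono.add_le_nat k 0
    rw [bertrandWeights_zero] at this
    simp at this
    omega
  have hgrow : IsGrowing (fabre d q) 0 := by
    unfold IsGrowing
    simp only [length_powWord_fabre_zero hq]
    exact hmono.tendsto_atTop
  have hu0 : limitWord (fabre d q) 0 0 = 0 := rfl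
  refine ⟨hu0, ⟨⟨fun c => by simp [fabre], 0, hgrow⟩, isFixedPoint_limitWord ha hlen,
    hu0.symm ▸ hgrow, fun n w => ?_⟩⟩
  unfold IsDTRep
  split_ifs with hn
  · have : sInf {k | n < bertrandWeights d k} = 0 :=
      Nat.sInf_eq_zero.mpr (Or.inl (hn ▸ bertrandWeights_pos d 0))
    rw [greedyRep, this, greedyDigits]
  rw [hu0]
  constructor
  · rintro ⟨m, b, s, hs, hm, hword, rfl⟩
    have hnl : n = (admWord (fabre d q) ((m, b) :: s)).length := by
      rw [← hword, wordPrefix_length]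
    have hlt := hs.length_admWord_lt hq
    rw [← hnl, Fin.val_zero, tailWeight_zero_right, List.length_cons] at hlt
    have hge : bertrandWeights d s.length ≤ n := by
      rw [hnl, hs.length_admWord_cons hq]
      exact (Nat.le_mul_of_pos_left _ (List.length_pos_of_ne_nil hm)).trans
        (Nat.le_add_right _ _)
    rw [greedyRep, sInf_weight_eq hmono.monotone hge hlt, ← hs.greedyDigits_eq hd hq, ← hnl,
      List.length_cons]
  · rintro rfl
    have hne : {k | n < bertrandWeights d k}.Nonempty :=
      ⟨n, by have := hlen n; rwa [length_powWord_fabre_zero hq] at this⟩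
    have hmem : n < bertrandWeights d (sInf {k | n < bertrandWeights d k}) := Nat.sInf_mem hne
    rw [greedyRep]
    obtain ⟨k, hk⟩ : ∃ k, sInf {k | n < bertrandWeights d k} = k + 1 := by
      refine Nat.exists_eq_succ_of_ne_zero fun h => ?_
      rw [h, bertrandWeights_zero] at hmem
      omega
    rw [hk] at hmem ⊢
    have hge : bertrandWeights d k ≤ n :=
      not_lt.mp (Nat.notMem_of_lt_sInf (s := {k | n < bertrandWeights d k}) (by omega))
    obtain ⟨s, hs, hsk, hsn⟩ := exists_isAdmissible hd hq (k + 1) 0 n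
      (by rwa [Fin.val_zero, tailWeight_zero_right])
    have hdig := hs.greedyDigits_eq hd hq
    have hpre := hs.admWord_prefix
    rw [hsk, ← wordPrefix_limitWord ha hlen] at hpre
    have hword := eq_wordPrefix_of_prefix hpre
    rw [hsk, hsn] at hdig
    rw [hsn] at hword
    obtain _ | ⟨⟨m, b⟩, s⟩ := s
    · simp at hsk
    refine ⟨m, b, s, hs, ?_, hword.symm, hdig⟩
    rintro rfl
    rw [greedyDigits, List.map_cons, List.cons.injEq] at hdig
    have := Nat.div_pos hge (bertrandWeights_pos d k)
    simp only [List.length_nil] at hdig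
    omega

/-- Folding an ultimately periodic word with preperiod `M` and period `p` onto the letters
`0, …, M + p - 1`. -/
theorem exists_fabre_system {d : ℕ → ℕ} (h0 : 0 < d 0) (hd : IsShiftMaximal d)
    (hper : IsUltimatelyPeriodic d) :
    ∃ (N : ℕ) (μ : Fin (N + 1) → List (Fin (N + 1))) (u : ℕ → Fin (N + 1)),
      IsFabreLike μ ∧ u 0 = 0 ∧ IsDumontThomasSystem μ u (greedyRep (bertrandWeights d)) := by
  obtain ⟨M, p, hp, h⟩ := hper
  let q : Fin (M + p - 1 + 1) := ⟨M, by omega⟩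
  have hq : ∀ j, d (M + p - 1 + 1 + j) = d (q + j) := by
    intro j
    rw [show M + p - 1 + 1 + j = (M + j) + p by omega]
    exact h _ (by omega)
  exact ⟨M + p - 1, fabre d q, limitWord (fabre d q) 0, isFabreLike_fabre q h0,
    isDumontThomasSystem_fabre h0 hd hq⟩

/-! ### Expansions of `1` -/

/-- A word whose digits come from remainders in `[0, 1]` starting at the largest value `1` is
shift-maximal. The last assumption says that the remainders avoid `0`, or avoid `1` after the
start: it excludes the digit ambiguity between a remainder `0` and a remainder `1`. -/
lemma isShiftMaximal_of_remainders {β : ℝ} (hβ : 0 ≤ β) {d : ℕ → ℕ} {y : ℕ → ℝ}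
    (hy0 : y 0 = 1) (hy : ∀ i, 0 ≤ y i ∧ y i ≤ 1) (hstep : ∀ i, y (i + 1) = β * y i - d i)
    (hstrict : ∀ i j, y (j + 1) - y (i + 1) < 1) : IsShiftMaximal d := by
  intro i j h
  have hle : ∀ t ≤ j, y (i + t) ≤ y t := by
    intro t
    induction t with
    | zero => intro _; rw [hy0]; exact (hy _).2
    | succ t ih =>
      intro ht
      rw [← Nat.add_assoc, hstep, hstep, h t ht]
      have := mul_le_mul_of_nonneg_left (ih (by omega)) hβ
      linarith
  have h1 := mul_le_mul_of_nonneg_left (hle j le_rfl) hβ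
  have h2 := hstrict (i + j) j
  rw [hstep, hstep] at h2
  have h3 : (d (i + j) : ℝ) < d j + 1 := by linarith
  exact Nat.lt_succ_iff.mp (by exact_mod_cast h3)

lemma digit_zero_pos_of_remainders {β : ℝ} (hβ : 1 < β) {d : ℕ → ℕ} {y : ℕ → ℝ}
    (hy0 : y 0 = 1) (hy1 : y 1 ≤ 1) (hstep : y 1 = β * y 0 - d 0) : 0 < d 0 := by
  have : (0 : ℝ) < d 0 := by rw [hy0] at hstep; linarith
  exact_mod_cast this

section Beta

variable {β : ℝ}

lemma betaOrbit_mem (β : ℝ) (i : ℕ) : 0 ≤ betaOrbit β i ∧ betaOrbit β i ≤ 1 := by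
  cases i with
  | zero => simp [betaOrbit]
  | succ i => exact ⟨Int.fract_nonneg _, (Int.fract_lt_one _).le⟩

lemma betaOrbit_succ (hβ : 0 ≤ β) (i : ℕ) :
    betaOrbit β (i + 1) = β * betaOrbit β i - dBeta β i := by
  have h : 0 ≤ β * betaOrbit β i := mul_nonneg hβ (betaOrbit_mem β i).1
  rw [betaOrbit, Int.fract, dBeta, natCast_floor_eq_intCast_floor h]

lemma isShiftMaximal_dBeta (hβ : 0 ≤ β) : IsShiftMaximal (dBeta β) := by
  refine isShiftMaximal_of_remainders hβ (y := betaOrbit β) rfl (betaOrbit_mem β)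
    (betaOrbit_succ hβ) fun i j => ?_
  have h1 : betaOrbit β (j + 1) < 1 := Int.fract_lt_one _
  have h2 := (betaOrbit_mem β (i + 1)).1
  linarith

lemma dBeta_zero_pos (hβ : 1 < β) : 0 < dBeta β 0 :=
  digit_zero_pos_of_remainders hβ (y := betaOrbit β) rfl (betaOrbit_mem β 1).2
    (betaOrbit_succ (by linarith) 0)

lemma betaOrbit_eq_zero_of_le {i j : ℕ} (h : betaOrbit β i = 0) (hij : i ≤ j) :
    betaOrbit β j = 0 := by
  induction hij with
  | refl => exact h
  | step _ ih => rw [betaOrbit, ih]; simp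

/-- If all digits from `M` on vanish, so does the remainder: otherwise it would be multiplied by
`β` forever. -/
lemma betaOrbit_eq_zero_of_digits (hβ : 1 < β) {M : ℕ} (h : ∀ i, M ≤ i → dBeta β i = 0) :
    betaOrbit β M = 0 := by
  have hpow : ∀ k, betaOrbit β (M + k) = β ^ k * betaOrbit β M := by
    intro k
    induction k with
    | zero => simp
    | succ k ih =>
      rw [← Nat.add_assoc, betaOrbit_succ (by linarith), h _ (by omega), ih]
      push_cast
      ring
  by_contra hne
  have hpos : 0 < betaOrbit β M := lt_of_le_of_ne (betaOrbit_mem β M).1 (Ne.symm hne)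
  obtain ⟨k, hk⟩ := pow_unbounded_of_one_lt (1 / betaOrbit β M) hβ
  rw [div_lt_iff₀ hpos, ← hpow] at hk
  exact absurd (betaOrbit_mem β (M + k)).2 (not_le.mpr hk)

lemma IsParry.isUltimatelyPeriodic (hβ : IsParry β) : IsUltimatelyPeriodic (dBeta β) := by
  rcases hβ.2 with ⟨M, hM⟩ | h
  · exact ⟨M, 1, one_pos, fun i hi => by rw [hM _ hi, hM _ (by omega)]⟩
  · exact h

/-- For a finite expansion of length `ℓ`, the quasi-greedy remainders run periodically through
`x_0, …, x_{ℓ-1}`, where the value `x_ℓ = 0` is replaced by `x_0 = 1`. -/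
lemma exists_remainders_quasiGreedy (hβ : 1 < β) (h : IsFiniteExpansion (dBeta β)) :
    ∃ (ℓ : ℕ) (y : ℕ → ℝ), 0 < ℓ ∧ (∀ i, dBetaStar β (i + ℓ) = dBetaStar β i) ∧
      y 0 = 1 ∧ (∀ i, 0 < y i ∧ y i ≤ 1) ∧ ∀ i, y (i + 1) = β * y i - dBetaStar β i := by
  classical
  obtain ⟨ℓ, hℓ, hstar⟩ : ∃ ℓ, (∀ m, (∀ i, m ≤ i → dBeta β i = 0) ↔ ℓ ≤ m) ∧
      ∀ i, dBetaStar β i =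
        if i % ℓ + 1 = ℓ then dBeta β (i % ℓ) - 1 else dBeta β (i % ℓ) := by
    refine ⟨Nat.find h, fun m => ⟨fun hm => Nat.find_min' h hm, fun hm i hi =>
      Nat.find_spec h i (hm.trans hi)⟩, fun i => ?_⟩
    rw [dBetaStar, quasiGreedy, dif_pos h]
  have hb : 0 ≤ β := by linarith
  have hpos : 0 < ℓ := by
    by_contra h0
    have := (hℓ 0).mpr (by omega) 0 le_rfl
    exact (dBeta_zero_pos hβ).ne' this
  have hzero : betaOrbit β ℓ = 0 := betaOrbit_eq_zero_of_digits hβ ((hℓ ℓ).mpr le_rfl)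
  have hne : ∀ i < ℓ, 0 < betaOrbit β i := by
    intro i hi
    refine lt_of_le_of_ne (betaOrbit_mem β i).1 fun h0 => ?_
    refine absurd ((hℓ i).mp fun j hj => ?_) (not_le.mpr hi)
    rw [dBeta, betaOrbit_eq_zero_of_le h0.symm hj]
    simp
  refine ⟨ℓ, fun i => betaOrbit β (i % ℓ), hpos, fun i => by simp [hstar], by
    simp [betaOrbit], fun i => ⟨hne _ (Nat.mod_lt _ hpos), (betaOrbit_mem β _).2⟩, fun i => ?_⟩
  have hi := Nat.mod_lt i hpos
  have hs := betaOrbit_succ hb (i % ℓ)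
  simp only [hstar]
  split_ifs with hlast
  · -- The last digit of the period is nonzero, so the truncated subtraction is exact.
    have hmod : (i + 1) % ℓ = 0 := by rw [← Nat.mod_add_mod, hlast, Nat.mod_self]
    rw [hlast, hzero] at hs
    have hd : (0 : ℝ) < dBeta β (i % ℓ) := by
      have := mul_pos (show 0 < β by linarith) (hne _ hi)
      linarith
    have hd' : 1 ≤ dBeta β (i % ℓ) := by exact_mod_cast hd
    rw [hmod, Nat.cast_sub hd', betaOrbit]
    push_cast
    linarith
  · have hmod : (i + 1) % ℓ = i % ℓ + 1 := by
      rw [← Nat.mod_add_mod, Nat.mod_eq_of_lt (by omega)]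
    rw [hmod, hs]

lemma IsParry.dBetaStar_properties (hβ : IsParry β) :
    0 < dBetaStar β 0 ∧ IsShiftMaximal (dBetaStar β) ∧ IsUltimatelyPeriodic (dBetaStar β) := by
  by_cases h : IsFiniteExpansion (dBeta β)
  · obtain ⟨ℓ, y, hpos, hper, hy0, hy, hstep⟩ := exists_remainders_quasiGreedy hβ.1 h
    refine ⟨digit_zero_pos_of_remainders hβ.1 hy0 (hy 1).2 (hstep 0),
      isShiftMaximal_of_remainders (by linarith [hβ.1]) hy0
        (fun i => ⟨(hy i).1.le, (hy i).2⟩) hstep fun i j => ?_,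
      0, ℓ, hpos, fun i _ => hper i⟩
    linarith [(hy (i + 1)).1, (hy (j + 1)).2]
  · have heq : dBetaStar β = dBeta β := by rw [dBetaStar, quasiGreedy, dif_neg h]
    rw [heq]
    exact ⟨dBeta_zero_pos hβ.1, isShiftMaximal_dBeta (by linarith [hβ.1]),
      hβ.isUltimatelyPeriodic⟩

end Beta

/-! ### The trivial system -/

/-- The digit word `1 0 0 0 ⋯` of the trivial system. -/
def oneZeros (i : ℕ) : ℕ := if i = 0 then 1 else 0

lemma isShiftMaximal_oneZeros : IsShiftMaximal oneZeros := by
  intro i j h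
  rcases Nat.eq_zero_or_pos j with rfl | hj
  · simp only [oneZeros]
    split_ifs <;> omega
  · simp only [oneZeros]
    rw [if_neg (by omega)]
    exact Nat.zero_le _

lemma bertrandWeights_oneZeros : bertrandWeights oneZeros = fun i => i + 1 := by
  funext i
  induction i with
  | zero => exact bertrandWeights_zero _
  | succ i ih =>
    have h1 : tailWeight oneZeros i (0 + 1) = 1 := by
      simp only [tailWeight, oneZeros]
      rw [Finset.sum_eq_zero fun j _ => by rw [if_neg (by omega), Nat.zero_mul]]
    rw [← tailWeight_zero_right, tailWeight_succ, h1, ih]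
    simp [oneZeros]

end DTNum

theorem mainTheorem7 (rep : ℕ → List ℕ) (hrep : DTNum.IsParryBertrandSystem rep) :
    ∃ (N : ℕ) (μ : Fin (N + 1) → List (Fin (N + 1))) (u : ℕ → Fin (N + 1)),
      DTNum.IsFabreLike μ ∧ u 0 = 0 ∧ DTNum.IsDumontThomasSystem μ u rep := by
  cases hrep with
  | canonical β hβ =>
    obtain ⟨h0, hmax, hper⟩ := hβ.dBetaStar_properties
    exact DTNum.exists_fabre_system h0 hmax hper
  | noncanonical β hβ =>
    exact DTNum.exists_fabre_system (DTNum.dBeta_zero_pos hβ.1)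
      (DTNum.isShiftMaximal_dBeta (by linarith [hβ.1])) hβ.isUltimatelyPeriodic
  | trivial =>
    rw [← DTNum.bertrandWeights_oneZeros]
    exact DTNum.exists_fabre_system Nat.one_pos DTNum.isShiftMaximal_oneZeros
      ⟨1, 1, one_pos, fun i hi => by
        rw [DTNum.oneZeros, DTNum.oneZeros, if_neg (by omega), if_neg (by omega)]⟩
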